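/- Let $G^{(n)}$, $n\in\mathbb{N}$, be finite abelian groups with $|G^{(n)}|\to\infty$, and let $\alpha\in[0,1]$. For each $n$ let $\{Y_a^{(n)} : a\in G^{(n)}\}$ be independent complex random variables (on a probability space that may depend on $n$) such that \[ \mathbb{E}Y_a^{(n)}=0,\qquad \mathbb{E}|Y_a^{(n)}|^2=1,\qquad \mathbb{E}\bigl(Y_a^{(n)}\bigr)^2=\alpha \qquad\text{for every } a\in G^{(n)}. \] Suppose that for every $\varepsilon>0$ \[ \lim_{n\to\infty}\frac{1}{|G^{(n)}|}\sum_{a\in G^{(n)}}\mathbb{E}\Bigl(|Y_a^{(n)}|^2\,\mathbf{1}_{\{|Y_a^{(n)}|\ge\varepsilon\sqrt{|G^{(n)}|}\}}\Bigr)=0, \] and that the limit \[ p=\lim_{n\to\infty}\frac{|\{a\in G^{(n)} : a^2=1\}|}{|G^{(n)}|} \] exists. Let $\mu^{(n)}$ be the empirical spectral measure (the eigenvalues being counted with multiplicity and each given mass $1/|G^{(n)}|$) of the random $G^{(n)}$-circulant matrix \[ M^{(n)}=\Bigl[\,|G^{(n)}|^{-1/2}\,Y^{(n)}_{ab^{-1}}\Bigr]_{a,b\in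 G^{(n)}}. \] Let $\gamma_\alpha$ be the centered Gaussian measure on $\mathbb{C}\cong\mathbb{R}^2$ with covariance matrix $\frac12\begin{pmatrix}1+\alpha&0\\0&1-\alpha\end{pmatrix}$ (degenerate on $\mathbb{R}$ if $\alpha=1$), and let $\gamma_{\mathbb{C}}=\gamma_0$ be the standard complex Gaussian measure. Put $\nu=(1-p)\gamma_{\mathbb{C}}+p\,\gamma_\alpha$. Then $\mu^{(n)}$ converges weakly to $\nu$ in mean and in probability. That is, for every bounded continuous $f:\mathbb{C}\to\mathbb{R}$, \[ \int f\,d\bigl(\mathbb{E}\mu^{(n)}\bigr)\to\int f\,d\nu \qquad\text{and}\qquad \int f\,d\mu^{(n)}\to\int f\,d\nu\ \text{ in probability,} \] where $\mathbb{E}\mu^{(n)}$ is the mean measure, $(\mathbb{E}\mu^{(n)})(B)=\mathbb{E}\bigl(\mu^{(n)}(B)\bigr)$ for Borel sets $B\subseteq\mathbb{C}$. -/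

import Mathlib

open MeasureTheory ProbabilityTheory Filter Topology BoundedContinuousFunction
open scoped ENNReal

noncomputable section

/-- The matrix `[|G|^{-1/2} Y_{a b⁻¹}]_{a, b ∈ G}`, the normalized `G`-circulant matrix generated by
the numbers `Y_a`, `a ∈ G`. -/
def circulantMatrix {G : Type*} [CommGroup G] [Fintype G] (Y : G → ℂ) : Matrix G G ℂ :=
  Matrix.of fun a b => ((Real.sqrt (Fintype.card G) : ℝ) : ℂ)⁻¹ * Y (a * b⁻¹)

/-- The empirical spectral measure of a square complex matrix: the eigenvalues are counted with
algebraic multiplicity, as roots of the characteristic polynomial. -/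
def empiricalSpectralMeasure {ι : Type*} [Fintype ι] [DecidableEq ι] (A : Matrix ι ι ℂ) :
    Measure ℂ :=
  (Fintype.card ι : ℝ≥0∞)⁻¹ • (A.charpoly.roots.map fun z => Measure.dirac z).sum

/-- The proportion of elements `a` of the finite group `G` with `a ^ 2 = 1`. -/
def propOrderTwo (G : Type*) [CommGroup G] [Fintype G] : ℝ :=
  (Nat.card {a : G // a ^ 2 = 1} : ℝ) / (Fintype.card G : ℝ)

/-- For `α ∈ [0, 1]`, the centered Gaussian measure on `ℂ ≅ ℝ²` with covariance matrix
`diag ((1 + α) / 2, (1 - α) / 2)`. -/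
def gaussianComplex (α : ℝ) : Measure ℂ :=
  ((gaussianReal 0 ((1 + α) / 2).toNNReal).prod (gaussianReal 0 ((1 - α) / 2).toNNReal)).map
    fun x : ℝ × ℝ => (⟨x.1, x.2⟩ : ℂ)

/-- The standard complex Gaussian measure, with independent real and imaginary parts of
variance `1 / 2`, so that `E |Z|² = 1`. -/
def stdGaussianComplex : Measure ℂ :=
  ((gaussianReal 0 (1 / 2)).prod (gaussianReal 0 (1 / 2))).map
    fun x : ℝ × ℝ => (⟨x.1, x.2⟩ : ℂ)

/-- The Lindeberg-type condition for the arrays `Y n a`, `a ∈ G n`. -/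
def LindebergCondition {G : ℕ → Type*} [∀ n, Fintype (G n)]
    {Ω : ℕ → Type*} [∀ n, MeasurableSpace (Ω n)] (P : ∀ n, Measure (Ω n))
    (Y : ∀ n, G n → Ω n → ℂ) : Prop :=
  ∀ ε : ℝ, 0 < ε →
    Tendsto (fun n => (1 / (Fintype.card (G n) : ℝ)) *
      ∑ a, ∫ ω in {ω | ε * Real.sqrt (Fintype.card (G n)) ≤ ‖Y n a ω‖}, ‖Y n a ω‖ ^ 2 ∂(P n))
      atTop (𝓝 0)

/-- The random measures `μ n` converge weakly in mean to `ν`: they are measurable maps into the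
space of measures, and their mean measures `E (μ n) = (P n).bind (μ n)` converge weakly to `ν`. -/
def WeaklyConvergesInMean {Ω : ℕ → Type*} [∀ n, MeasurableSpace (Ω n)] (P : ∀ n, Measure (Ω n))
    (μ : ∀ n, Ω n → Measure ℂ) (ν : Measure ℂ) : Prop :=
  (∀ n, Measurable (μ n)) ∧
    ∀ f : ℂ →ᵇ ℝ, Tendsto (fun n => ∫ z, f z ∂((P n).bind (μ n))) atTop (𝓝 (∫ z, f z ∂ν))

/-- The random measures `μ n` converge weakly in probability to the deterministic measure `ν`. -/
def WeaklyConvergesInProbability {Ω : ℕ → Type*} [∀ n, MeasurableSpace (Ω n)]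
    (P : ∀ n, Measure (Ω n)) (μ : ∀ n, Ω n → Measure ℂ) (ν : Measure ℂ) : Prop :=
  ∀ f : ℂ →ᵇ ℝ, ∀ ε : ℝ, 0 < ε →
    Tendsto (fun n => P n {ω | ε ≤ |∫ z, f z ∂(μ n ω) - ∫ z, f z ∂ν|}) atTop (𝓝 0)

end

/-! ### Averages of measures and mean empirical measures -/

noncomputable section AverageMeasure

/-! The characters of `G` diagonalize every `G`-circulant matrix, so the eigenvalues are the
normalized Fourier coefficients `Z_χ = |G|^{-1/2} ∑ Y_a χ(a)` and the spectral measure is the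
uniform average of the `dirac Z_χ` (`empiricalSpectralMeasure_circulantMatrix`).

Both modes of convergence follow from one second-moment statement: the law of `(Z_χ, Z_ψ)`, averaged
over all pairs of characters, converges to `ν ⊗ ν`. By Lévy's continuity theorem it suffices to
treat characteristic functions. The real inner product of `(Z_χ, Z_ψ)` with `(s, t)` is a sum of
independent terms `Re (Y_a c_a) / √|G|` with uniformly bounded weights, so the quantitative
Lindeberg theorem `norm_integral_exp_sum_sub_exp_le` replaces it by a Gaussian of the same variance.

Orthogonality of characters evaluates that variance (`sum_variance_pair_eq`). Unless `ψ = χ` or `ψ =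
χ⁻¹` the cross terms vanish, so the pair is asymptotically independent. The pseudo-variance `α`
survives at `χ` exactly when `χ² = 1`, which gives `γ_α` for such `χ` and `γ_0` for the others. The
exceptional pairs are at most `2|G|` among `|G|²`, and there are as many `χ` with `χ² = 1` as `a`
with `a² = 1`, whence the weight `p`. -/

/-- The average of a finite family of measures. -/
def averageMeasure {ι E : Type*} [Fintype ι] [MeasurableSpace E] (μ : ι → Measure E) : Measure E :=
  (Fintype.card ι : ℝ≥0∞)⁻¹ • ∑ i, μ i

variable {ι E : Type*} [Fintype ι] [MeasurableSpace E]

lemma averageMeasure_isProbabilityMeasure [Nonempty ι] (μ : ι → Measure E)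
    [∀ i, IsProbabilityMeasure (μ i)] : IsProbabilityMeasure (averageMeasure μ) := by
  constructor
  simp only [averageMeasure, Measure.smul_apply, Measure.coe_finsetSum, Finset.sum_apply,
    measure_univ, Finset.sum_const, Finset.card_univ, nsmul_eq_mul, mul_one, smul_eq_mul]
  exact ENNReal.inv_mul_cancel (by simp) (by simp)

lemma integral_averageMeasure {F : Type*} [NormedAddCommGroup F] [NormedSpace ℝ F]
    (μ : ι → Measure E) {f : E → F} (hf : ∀ i, Integrable f (μ i)) :
    ∫ x, f x ∂(averageMeasure μ) = (Fintype.card ι : ℝ)⁻¹ • ∑ i, ∫ x, f x ∂(μ i) := by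
  rw [averageMeasure, integral_smul_measure, integral_finsetSum_measure fun i _ => hf i]
  simp

lemma measurable_averageMeasure_dirac {Ω : Type*} [MeasurableSpace Ω]
    {Z : ι → Ω → E} (hZ : ∀ i, Measurable (Z i)) :
    Measurable fun ω => averageMeasure fun i => Measure.dirac (Z i ω) := by
  refine Measure.measurable_of_measurable_coe _ fun s hs => ?_
  simp only [averageMeasure, Measure.smul_apply, Measure.coe_finsetSum, Finset.sum_apply,
    smul_eq_mul]
  exact (Finset.measurable_sum _ fun i _ =>
    (Measure.measurable_coe hs).comp (Measure.measurable_dirac.comp (hZ i))).const_mul _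

/-- Turns integrals against the mean measure into averages of expectations. -/
lemma bind_averageMeasure_dirac {Ω : Type*} [MeasurableSpace Ω] (P : Measure Ω)
    {Z : ι → Ω → E} (hZ : ∀ i, Measurable (Z i)) :
    P.bind (fun ω => averageMeasure fun i => Measure.dirac (Z i ω)) =
      averageMeasure fun i => P.map (Z i) := by
  ext s hs
  rw [Measure.bind_apply hs (measurable_averageMeasure_dirac hZ).aemeasurable]
  simp only [averageMeasure, Measure.smul_apply, Measure.coe_finsetSum, Finset.sum_apply,
    smul_eq_mul]
  have h (i : ι) : Measurable fun ω => Measure.dirac (Z i ω) s :=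
    (Measure.measurable_coe hs).comp (Measure.measurable_dirac.comp (hZ i))
  rw [lintegral_const_mul _ (Finset.measurable_sum _ fun i _ => h i),
    lintegral_finsetSum _ fun i _ => h i]
  congr 1
  refine Finset.sum_congr rfl fun i _ => ?_
  rw [← Measure.bind_dirac_eq_map _ (hZ i)]
  exact (Measure.bind_apply hs (Measure.measurable_dirac.comp (hZ i)).aemeasurable).symm

end AverageMeasure

/-! ### From averaged pair laws to convergence in mean and in probability -/

section PairConvergence

open Complex
open scoped RealInnerProductSpace

variable {I : ℕ → Type*} [∀ n, Fintype (I n)] [∀ n, Nonempty (I n)]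
  {Ω : ℕ → Type*} [∀ n, MeasurableSpace (Ω n)] {P : ∀ n, Measure (Ω n)}
  [∀ n, IsProbabilityMeasure (P n)] {Z : ∀ n, I n → Ω n → ℂ}
  {ν : Measure ℂ} [IsProbabilityMeasure ν]

/-- If the averaged characteristic functions of the pairs `(Z i, Z j)` converge to that of
`ν.prod ν`, then the averaged laws of the pairs converge weakly to `ν.prod ν`. -/
lemma tendsto_average_integral_mul_of_tendsto_charFun (hZ : ∀ n i, Measurable (Z n i))
    (h : ∀ s t : ℂ, Tendsto (fun n => ((Fintype.card (I n × I n) : ℝ)⁻¹ : ℝ) •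
      ∑ q : I n × I n, ∫ ω, exp ((⟪Z n q.1 ω, s⟫ + ⟪Z n q.2 ω, t⟫ : ℝ) * Complex.I) ∂(P n)) atTop
      (𝓝 (charFun ν s * charFun ν t))) (f g : ℂ →ᵇ ℝ) :
    Tendsto (fun n => (Fintype.card (I n × I n) : ℝ)⁻¹ *
      ∑ q : I n × I n, ∫ ω, f (Z n q.1 ω) * g (Z n q.2 ω) ∂(P n)) atTop
      (𝓝 ((∫ z, f z ∂ν) * ∫ z, g z ∂ν)) := by
  have hm (n : ℕ) (q : I n × I n) :
      Measurable fun ω => WithLp.toLp 2 (Z n q.1 ω, Z n q.2 ω) :=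
    (MeasurableEquiv.toLp 2 (ℂ × ℂ)).measurable.comp ((hZ n q.1).prodMk (hZ n q.2))
  have hp (n : ℕ) (q : I n × I n) : IsProbabilityMeasure
      ((P n).map fun ω => WithLp.toLp 2 (Z n q.1 ω, Z n q.2 ω)) :=
    Measure.isProbabilityMeasure_map (hm n q).aemeasurable
  have hL : Measurable (WithLp.toLp 2 : ℂ × ℂ → WithLp 2 (ℂ × ℂ)) :=
    (MeasurableEquiv.toLp 2 (ℂ × ℂ)).measurable
  -- The plain product carries the sup norm; the `L²` product supplies the inner product that
  -- `charFun` requires.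
  let Q : ℕ → ProbabilityMeasure (WithLp 2 (ℂ × ℂ)) := fun n =>
    ⟨averageMeasure fun q : I n × I n => (P n).map fun ω => WithLp.toLp 2 (Z n q.1 ω, Z n q.2 ω),
      averageMeasure_isProbabilityMeasure _⟩
  let Q₀ : ProbabilityMeasure (WithLp 2 (ℂ × ℂ)) :=
    ⟨(ν.prod ν).map (WithLp.toLp 2), Measure.isProbabilityMeasure_map hL.aemeasurable⟩
  have hQ : Tendsto Q atTop (𝓝 Q₀) := by
    refine ProbabilityMeasure.tendsto_of_tendsto_charFun fun t => ?_
    have e0 : charFun (Q₀ : Measure (WithLp 2 (ℂ × ℂ))) t =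
        charFun ν t.fst * charFun ν t.snd := charFun_prod t
    rw [e0]
    refine (h t.fst t.snd).congr fun n => ?_
    have hc : Continuous fun x : WithLp 2 (ℂ × ℂ) => exp ((⟪x, t⟫ : ℝ) * Complex.I) := by
      fun_prop
    have hi (q : I n × I n) : Integrable (fun x : WithLp 2 (ℂ × ℂ) =>
        exp ((⟪x, t⟫ : ℝ) * Complex.I))
        ((P n).map fun ω => WithLp.toLp 2 (Z n q.1 ω, Z n q.2 ω)) :=
      Integrable.of_bound hc.aestronglyMeasurable 1 (ae_of_all _ fun x => by
        rw [Complex.norm_exp_ofReal_mul_I])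
    simp only [Q, ProbabilityMeasure.coe_mk, charFun_apply]
    rw [integral_averageMeasure _ hi]
    congr 1
    refine Finset.sum_congr rfl fun q _ => ?_
    rw [integral_map (hm n q).aemeasurable hc.aestronglyMeasurable]
    simp only [WithLp.prod_inner_apply]
    rfl
  rw [ProbabilityMeasure.tendsto_iff_forall_integral_tendsto] at hQ
  let F : WithLp 2 (ℂ × ℂ) →ᵇ ℝ :=
    (f.compContinuous ⟨fun x => x.fst, by fun_prop⟩) *
      (g.compContinuous ⟨fun x => x.snd, by fun_prop⟩)
  have hF := hQ F
  have e0 : ∫ x, F x ∂(Q₀ : Measure (WithLp 2 (ℂ × ℂ))) = (∫ z, f z ∂ν) * ∫ z, g z ∂ν := by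
    simp only [Q₀, ProbabilityMeasure.coe_mk]
    rw [integral_map hL.aemeasurable F.continuous.aestronglyMeasurable]
    exact integral_prod_mul (fun z => f z) (fun z => g z)
  rw [e0] at hF
  refine hF.congr fun n => ?_
  simp only [Q, ProbabilityMeasure.coe_mk]
  rw [integral_averageMeasure _ fun q => F.integrable _, smul_eq_mul]
  congr 1
  refine Finset.sum_congr rfl fun q _ => ?_
  rw [integral_map (hm n q).aemeasurable F.continuous.aestronglyMeasurable]
  rfl

lemma integral_averageMeasure_dirac {ι : Type*} [Fintype ι] (z : ι → ℂ) (f : ℂ →ᵇ ℝ) :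
    ∫ x, f x ∂(averageMeasure fun i => Measure.dirac (z i)) =
      (Fintype.card ι : ℝ)⁻¹ * ∑ i, f (z i) := by
  rw [integral_averageMeasure _ fun i => f.integrable _]
  simp

lemma weaklyConvergesInMean_of_tendsto_average (hZ : ∀ n i, Measurable (Z n i))
    (h : ∀ f g : ℂ →ᵇ ℝ, Tendsto (fun n => (Fintype.card (I n × I n) : ℝ)⁻¹ *
      ∑ q : I n × I n, ∫ ω, f (Z n q.1 ω) * g (Z n q.2 ω) ∂(P n)) atTop
      (𝓝 ((∫ z, f z ∂ν) * ∫ z, g z ∂ν))) :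
    WeaklyConvergesInMean P (fun n ω => averageMeasure fun i => Measure.dirac (Z n i ω)) ν := by
  refine ⟨fun n => measurable_averageMeasure_dirac (hZ n), fun f => ?_⟩
  -- With second test function 1 the average over pairs collapses to an average over single indices.
  have h1 := h f (BoundedContinuousFunction.const ℂ 1)
  simp only [BoundedContinuousFunction.const_apply, mul_one, integral_const, probReal_univ,
    smul_eq_mul] at h1
  refine h1.congr fun n => ?_
  have hp (i : I n) : IsProbabilityMeasure ((P n).map (Z n i)) :=
    Measure.isProbabilityMeasure_map (hZ n i).aemeasurable
  rw [bind_averageMeasure_dirac _ (hZ n), integral_averageMeasure _ fun i => f.integrable _,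
    Fintype.sum_prod_type]
  have hN : (Fintype.card (I n) : ℝ) ≠ 0 := by simp
  simp only [Finset.sum_const, Finset.card_univ, nsmul_eq_mul, ← Finset.mul_sum,
    Fintype.card_prod, Nat.cast_mul, smul_eq_mul]
  rw [mul_inv, mul_assoc, inv_mul_cancel_left₀ hN]
  congr 1
  refine Finset.sum_congr rfl fun i _ => ?_
  rw [integral_map (hZ n i).aemeasurable f.continuous.aestronglyMeasurable]

/-- Chebyshev's inequality: after centering `f` at its `ν`-mean, the second moment of the empirical
average is exactly the pair average, whose limit is `0 * 0`. -/
lemma weaklyConvergesInProbability_of_tendsto_average (hZ : ∀ n i, Measurable (Z n i))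
    (h : ∀ f g : ℂ →ᵇ ℝ, Tendsto (fun n => (Fintype.card (I n × I n) : ℝ)⁻¹ *
      ∑ q : I n × I n, ∫ ω, f (Z n q.1 ω) * g (Z n q.2 ω) ∂(P n)) atTop
      (𝓝 ((∫ z, f z ∂ν) * ∫ z, g z ∂ν))) :
    WeaklyConvergesInProbability P
      (fun n ω => averageMeasure fun i => Measure.dirac (Z n i ω)) ν := by
  intro f ε hε
  set m : ℝ := ∫ z, f z ∂ν with hmdef
  let g : ℂ →ᵇ ℝ := f - BoundedContinuousFunction.const ℂ m
  have hg0 : ∫ z, g z ∂ν = 0 := by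
    have : ∫ z, g z ∂ν = ∫ z, (f z - m) ∂ν := rfl
    rw [this, integral_sub (f.integrable _) (integrable_const _)]
    simp [hmdef]
  have h1 := h g g
  rw [hg0, mul_zero] at h1
  let D : ∀ n, Ω n → ℝ := fun n ω => (Fintype.card (I n) : ℝ)⁻¹ * ∑ i, g (Z n i ω)
  have hD (n : ℕ) (ω : Ω n) :
      ∫ z, f z ∂(averageMeasure fun i => Measure.dirac (Z n i ω)) - m = D n ω := by
    have hN : (Fintype.card (I n) : ℝ) ≠ 0 := by simp
    have e (i : I n) : g (Z n i ω) = f (Z n i ω) - m := rfl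
    simp only [D, integral_averageMeasure_dirac, e, Finset.sum_sub_distrib, Finset.sum_const,
      Finset.card_univ, nsmul_eq_mul, mul_sub]
    rw [inv_mul_cancel_left₀ hN]
  have hgm (n : ℕ) (i : I n) : Measurable fun ω => g (Z n i ω) :=
    g.continuous.measurable.comp (hZ n i)
  have hgi (n : ℕ) (q : I n × I n) : Integrable (fun ω => g (Z n q.1 ω) * g (Z n q.2 ω)) (P n) :=
    Integrable.of_bound ((hgm n q.1).mul (hgm n q.2)).aestronglyMeasurable (‖g‖ * ‖g‖)
      (ae_of_all _ fun ω => by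
        rw [norm_mul]
        exact mul_le_mul (g.norm_coe_le_norm _) (g.norm_coe_le_norm _) (norm_nonneg _)
          (norm_nonneg _))
  have hsqe (n : ℕ) (ω : Ω n) : D n ω ^ 2 = (Fintype.card (I n × I n) : ℝ)⁻¹ *
      ∑ q : I n × I n, g (Z n q.1 ω) * g (Z n q.2 ω) := by
    simp only [D, Fintype.card_prod, Nat.cast_mul, mul_inv]
    rw [mul_pow, sq (∑ i, g (Z n i ω)), Finset.sum_mul_sum, Fintype.sum_prod_type]
    ring
  have hsqi (n : ℕ) : Integrable (fun ω => D n ω ^ 2) (P n) := by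
    simp only [hsqe]
    exact (integrable_finsetSum _ fun q _ => hgi n q).const_mul _
  have hint (n : ℕ) : ∫ ω, D n ω ^ 2 ∂(P n) = (Fintype.card (I n × I n) : ℝ)⁻¹ *
      ∑ q : I n × I n, ∫ ω, g (Z n q.1 ω) * g (Z n q.2 ω) ∂(P n) := by
    simp only [hsqe]
    rw [integral_const_mul, integral_finsetSum _ fun q _ => hgi n q]
  simp only [← hint] at h1
  simp only [hD]
  have h2 : Tendsto (fun n => ENNReal.ofReal ((∫ ω, D n ω ^ 2 ∂(P n)) / ε ^ 2)) atTop (𝓝 0) := by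
    have := ENNReal.tendsto_ofReal (h1.div_const (ε ^ 2))
    simpa using this
  refine tendsto_of_tendsto_of_tendsto_of_le_of_le tendsto_const_nhds h2 (fun n => zero_le)
    fun n => ?_
  have hmk := mul_meas_ge_le_integral_of_nonneg (ae_of_all (P n) fun ω => sq_nonneg (D n ω))
    (hsqi n) (ε ^ 2)
  have hset : {ω | ε ≤ |D n ω|} = {ω | ε ^ 2 ≤ D n ω ^ 2} := by
    ext ω
    simp only [Set.mem_ofPred_eq, ← sq_abs (D n ω)]
    exact (pow_le_pow_iff_left₀ hε.le (abs_nonneg _) two_ne_zero).symm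
  rw [hset, ← ofReal_measureReal]
  refine ENNReal.ofReal_le_ofReal ?_
  rw [le_div_iff₀ (by positivity), mul_comm]
  exact hmk

end PairConvergence

/-! ### A quantitative Lindeberg theorem -/

section Lindeberg

open Complex

/-- Factors are exchanged one at a time; the untouched ones have norm at most 1. -/
lemma norm_prod_sub_prod_le_sum {ι : Type*} (s : Finset ι) {a b : ι → ℂ}
    (ha : ∀ i ∈ s, ‖a i‖ ≤ 1) (hb : ∀ i ∈ s, ‖b i‖ ≤ 1) :
    ‖∏ i ∈ s, a i - ∏ i ∈ s, b i‖ ≤ ∑ i ∈ s, ‖a i - b i‖ := by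
  classical
  induction s using Finset.induction_on with
  | empty => simp
  | insert j s hj ih =>
    rw [Finset.prod_insert hj, Finset.prod_insert hj, Finset.sum_insert hj]
    have h1 : ‖∏ i ∈ s, b i‖ ≤ 1 := by
      rw [norm_prod]
      exact Finset.prod_le_one (fun i _ => norm_nonneg _)
        fun i hi => hb i (Finset.mem_insert_of_mem hi)
    have h2 := ih (fun i hi => ha i (Finset.mem_insert_of_mem hi))
      fun i hi => hb i (Finset.mem_insert_of_mem hi)
    calc ‖a j * ∏ i ∈ s, a i - b j * ∏ i ∈ s, b i‖
        = ‖(a j - b j) * ∏ i ∈ s, b i + a j * (∏ i ∈ s, a i - ∏ i ∈ s, b i)‖ := by ring_nf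
      _ ≤ ‖a j - b j‖ * ‖∏ i ∈ s, b i‖ + ‖a j‖ * ‖∏ i ∈ s, a i - ∏ i ∈ s, b i‖ :=
          (norm_add_le _ _).trans_eq (by rw [norm_mul, norm_mul])
      _ ≤ ‖a j - b j‖ * 1 + 1 * ∑ i ∈ s, ‖a i - b i‖ := by
          gcongr
          exact ha j (Finset.mem_insert_self _ _)
      _ = _ := by ring

/-- For `|x| ≤ 1` the remainder is at most `|x|³`, hence at most `δ x²` below `δ` and at most `x²`
above it. For `|x| > 1` the crude bound `2 + |x| + x²/2` is below `4 x²`. -/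
lemma norm_exp_mul_I_sub_taylor_le {δ : ℝ} (hδ : 0 ≤ δ) (hδ1 : δ ≤ 1) (x : ℝ) :
    ‖exp (x * I) - (1 + x * I - x ^ 2 / 2)‖ ≤ δ * x ^ 2 + 4 * (if δ ≤ |x| then x ^ 2 else 0) := by
  rcases le_or_gt |x| 1 with hx | hx
  · have h := Complex.exp_bound (x := x * I) (n := 3) (by simpa using hx) (by norm_num)
    have e : ∑ m ∈ Finset.range 3, ((x : ℂ) * I) ^ m / m.factorial =
        1 + x * I - x ^ 2 / 2 := by
      simp [Finset.sum_range_succ, Nat.factorial, mul_pow]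
      ring
    have h3 : ‖(x : ℂ) * I‖ = |x| := by simp
    rw [e, h3] at h
    have h4 : ‖exp (x * I) - (1 + x * I - x ^ 2 / 2)‖ ≤ |x| * x ^ 2 := by
      refine h.trans ?_
      have e3 : |x| * x ^ 2 = |x| ^ 3 := by rw [← sq_abs x]; ring
      rw [e3]
      exact mul_le_of_le_one_right (by positivity) (by norm_num [Nat.factorial])
    refine h4.trans ?_
    split_ifs with hd
    · nlinarith [sq_nonneg x, mul_nonneg hδ (sq_nonneg x)]
    · push Not at hd
      nlinarith [sq_nonneg x]
  · have h0 : ‖exp (x * I) - (1 + x * I - x ^ 2 / 2)‖ ≤ 1 + (1 + |x| + x ^ 2 / 2) := by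
      refine (norm_sub_le _ _).trans ?_
      rw [Complex.norm_exp_ofReal_mul_I]
      gcongr
      refine (norm_sub_le _ _).trans ?_
      gcongr
      · refine (norm_add_le _ _).trans ?_
        simp
      · simp
    have h1 : 1 + (1 + |x| + x ^ 2 / 2) ≤ 4 * x ^ 2 := by
      rw [← sq_abs x]; nlinarith
    rw [if_pos (hδ1.trans hx.le)]
    nlinarith [mul_nonneg hδ (sq_nonneg x)]

lemma re_sq_eq (w : ℂ) : w.re ^ 2 = (‖w‖ ^ 2 + (w ^ 2).re) / 2 := by
  rw [Complex.sq_norm, Complex.normSq_apply, sq w, Complex.mul_re]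
  ring

section SingleVariable

variable {Ω : Type*} [MeasurableSpace Ω] {P : Measure Ω} [IsProbabilityMeasure P]
  {Y : Ω → ℂ} {α : ℝ}

omit [IsProbabilityMeasure P] in
lemma memLp_two_of_integral_sq_eq_one (hY : Measurable Y) (hvar : ∫ ω, ‖Y ω‖ ^ 2 ∂P = 1) :
    MemLp Y 2 P :=
  (memLp_two_iff_integrable_sq_norm hY.aestronglyMeasurable).2
    (Integrable.of_integral_ne_zero (by rw [hvar]; exact one_ne_zero))

lemma integral_re_mul_const (hY : Measurable Y) (hvar : ∫ ω, ‖Y ω‖ ^ 2 ∂P = 1)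
    (hmean : ∫ ω, Y ω ∂P = 0) (c : ℂ) : ∫ ω, (Y ω * c).re ∂P = 0 := by
  have hi : Integrable (fun ω => Y ω * c) P :=
    ((memLp_two_of_integral_sq_eq_one hY hvar).integrable one_le_two).mul_const c
  have h := integral_re hi
  rw [integral_mul_const, hmean, zero_mul] at h
  simpa using h

omit [IsProbabilityMeasure P] in
-- By `re_sq_eq`, the second moment of a real linear functional of `Y` involves only `E|Y|²` and `E
-- Y²`.
lemma integral_re_mul_const_sq (hY : Measurable Y) (hvar : ∫ ω, ‖Y ω‖ ^ 2 ∂P = 1)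
    (hsq : ∫ ω, Y ω ^ 2 ∂P = (α : ℂ)) (c : ℂ) :
    ∫ ω, (Y ω * c).re ^ 2 ∂P = (‖c‖ ^ 2 + α * (c ^ 2).re) / 2 := by
  have h2 := memLp_two_of_integral_sq_eq_one hY hvar
  have hi : Integrable (fun ω => ‖Y ω‖ ^ 2) P :=
    (memLp_two_iff_integrable_sq_norm hY.aestronglyMeasurable).1 h2
  have hi2 : Integrable (fun ω => Y ω ^ 2) P := by
    refine hi.mono' (hY.pow_const 2).aestronglyMeasurable (ae_of_all _ fun ω => ?_)
    rw [norm_pow]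
  have hi3 : Integrable (fun ω => Y ω ^ 2 * c ^ 2) P := hi2.mul_const _
  have h := integral_re hi3
  rw [integral_mul_const, hsq] at h
  have h' : ∫ ω, (Y ω ^ 2 * c ^ 2).re ∂P = α * (c ^ 2).re := by
    rw [← Complex.re_ofReal_mul]
    exact h
  simp only [re_sq_eq, norm_mul, mul_pow]
  have hi4 : Integrable (fun ω => (Y ω ^ 2 * c ^ 2).re) P := hi3.re
  rw [integral_div, integral_add (hi.mul_const _) hi4, integral_mul_const, hvar, one_mul, h']

lemma norm_integral_exp_sub_le (hY : Measurable Y) (hvar : ∫ ω, ‖Y ω‖ ^ 2 ∂P = 1)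
    (hmean : ∫ ω, Y ω ∂P = 0) (hsq : ∫ ω, Y ω ^ 2 ∂P = (α : ℂ)) {c : ℂ} {K δ R : ℝ}
    (hK : 0 < K) (hc : ‖c‖ ≤ K) (hδ : 0 < δ) (hδ1 : δ ≤ 1) (hR : 0 < R) :
    ‖∫ ω, exp (((Y ω * c).re / R : ℝ) * I) ∂P -
        ((1 - (‖c‖ ^ 2 + α * (c ^ 2).re) / (4 * R ^ 2) : ℝ) : ℂ)‖ ≤
      (δ * K ^ 2 + 4 * K ^ 2 * ∫ ω in {ω | δ / K * R ≤ ‖Y ω‖}, ‖Y ω‖ ^ 2 ∂P) / R ^ 2 := by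
  have h2 := memLp_two_of_integral_sq_eq_one hY hvar
  have hi : Integrable (fun ω => ‖Y ω‖ ^ 2) P :=
    (memLp_two_iff_integrable_sq_norm hY.aestronglyMeasurable).1 h2
  let X : Ω → ℝ := fun ω => (Y ω * c).re / R
  have hXm : Measurable X := by fun_prop
  have hYc : ∀ ω, |(Y ω * c).re| ≤ K * ‖Y ω‖ := fun ω => by
    refine (Complex.abs_re_le_norm _).trans ?_
    rw [norm_mul, mul_comm]
    gcongr
  have hXle : ∀ ω, |X ω| ≤ K * ‖Y ω‖ / R := fun ω => by
    simp only [X, abs_div, abs_of_pos hR]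
    gcongr
    exact hYc ω
  have hXsq : ∀ ω, X ω ^ 2 ≤ K ^ 2 / R ^ 2 * ‖Y ω‖ ^ 2 := fun ω => by
    rw [← sq_abs (X ω)]
    calc |X ω| ^ 2 ≤ (K * ‖Y ω‖ / R) ^ 2 := by gcongr; exact hXle ω
      _ = _ := by ring
  have hXi2 : Integrable (fun ω => X ω ^ 2) P := by
    refine (hi.const_mul (K ^ 2 / R ^ 2)).mono' (hXm.pow_const 2).aestronglyMeasurable
      (ae_of_all _ fun ω => ?_)
    rw [Real.norm_of_nonneg (sq_nonneg _)]
    exact hXsq ω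
  have hXi : Integrable X P :=
    ((memLp_two_iff_integrable_sq hXm.aestronglyMeasurable).2 hXi2).integrable one_le_two
  have hX0 : ∫ ω, X ω ∂P = 0 := by
    simp only [X]
    rw [integral_div, integral_re_mul_const hY hvar hmean, zero_div]
  have hX2 : ∫ ω, X ω ^ 2 ∂P = (‖c‖ ^ 2 + α * (c ^ 2).re) / (2 * R ^ 2) := by
    simp only [X, div_pow]
    rw [integral_div, integral_re_mul_const_sq hY hvar hsq, div_div]
  have hexpi : Integrable (fun ω => exp (X ω * I)) P :=
    Integrable.of_bound (by fun_prop) 1 (ae_of_all _ fun ω => by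
      rw [Complex.norm_exp_ofReal_mul_I])
  have hXiC : Integrable (fun ω => (X ω : ℂ)) P := hXi.ofReal
  have hXi2C : Integrable (fun ω => ((X ω ^ 2 : ℝ) : ℂ)) P := hXi2.ofReal
  have hXi2C' : Integrable (fun ω => (X ω : ℂ) ^ 2 / 2) P := by
    simpa using hXi2C.div_const 2
  have hlin : Integrable (fun ω => 1 + (X ω : ℂ) * I) P :=
    (integrable_const _).add (hXiC.mul_const I)
  have htay : Integrable (fun ω => 1 + (X ω : ℂ) * I - (X ω : ℂ) ^ 2 / 2) P := hlin.sub hXi2C'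
  have e : ∫ ω, (1 + (X ω : ℂ) * I - (X ω : ℂ) ^ 2 / 2) ∂P =
      ((1 - (‖c‖ ^ 2 + α * (c ^ 2).re) / (4 * R ^ 2) : ℝ) : ℂ) := by
    rw [integral_sub hlin hXi2C',
      integral_add (integrable_const _) (hXiC.mul_const I), integral_mul_const, integral_div,
      integral_complex_ofReal, hX0]
    have : ∫ ω, (X ω : ℂ) ^ 2 ∂P = ((∫ ω, X ω ^ 2 ∂P : ℝ) : ℂ) := by
      rw [← integral_complex_ofReal]
      simp
    rw [this, hX2]
    simp
    ring
  rw [← e, ← integral_sub hexpi htay]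
  have hS : MeasurableSet {ω | δ / K * R ≤ ‖Y ω‖} := measurableSet_le measurable_const hY.norm
  rw [← integral_indicator hS]
  have hbound : ∀ ω, ‖exp (X ω * I) - (1 + (X ω : ℂ) * I - (X ω : ℂ) ^ 2 / 2)‖ ≤
      δ * (K ^ 2 / R ^ 2) * ‖Y ω‖ ^ 2 + 4 * (K ^ 2 / R ^ 2) *
        {ω | δ / K * R ≤ ‖Y ω‖}.indicator (fun ω => ‖Y ω‖ ^ 2) ω := fun ω => by
    refine (norm_exp_mul_I_sub_taylor_le hδ.le hδ1 (X ω)).trans ?_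
    rw [mul_assoc δ, mul_assoc (4 : ℝ)]
    gcongr
    · exact hXsq ω
    · split_ifs with hd
      -- Since `|X| ≤ K‖Y‖/R`, the event `δ ≤ |X|` forces `‖Y‖` above `δ / K * R`, the Lindeberg
      -- threshold.
      · have hmem : ω ∈ {ω | δ / K * R ≤ ‖Y ω‖} := by
          have := hd.trans (hXle ω)
          rw [le_div_iff₀ hR] at this
          change δ / K * R ≤ ‖Y ω‖
          rw [div_mul_eq_mul_div, div_le_iff₀ hK]
          linarith
        rw [Set.indicator_of_mem hmem]
        exact hXsq ω
      · exact mul_nonneg (by positivity) (Set.indicator_nonneg (fun _ _ => sq_nonneg _) _)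
  have hind : Integrable ({ω | δ / K * R ≤ ‖Y ω‖}.indicator fun ω => ‖Y ω‖ ^ 2) P :=
    hi.indicator hS
  refine (norm_integral_le_of_norm_le ((hi.const_mul _).add (hind.const_mul _))
    (ae_of_all _ hbound)).trans_eq ?_
  rw [integral_add' (hi.const_mul _) (hind.const_mul _), integral_const_mul, integral_const_mul,
    hvar]
  ring

end SingleVariable

lemma abs_one_sub_sub_exp_neg_le {x : ℝ} (hx : 0 ≤ x) : |1 - x - Real.exp (-x)| ≤ x ^ 2 := by
  rcases le_or_gt x 1 with h | h
  · have := Real.norm_exp_sub_one_sub_id_le (x := -x) (by simpa [abs_of_nonneg hx] using h)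
    rw [Real.norm_eq_abs, Real.norm_eq_abs, sq_abs, neg_sq] at this
    rw [abs_sub_comm]
    convert this using 2
    ring
  · rw [abs_le]
    have h1 : Real.exp (-x) ≤ 1 := Real.exp_le_one_iff.2 (by linarith)
    have h2 := Real.exp_pos (-x)
    constructor <;> nlinarith

/-- A quantitative Lindeberg central limit theorem for weighted sums of complex variables. -/
lemma norm_integral_exp_sum_sub_exp_le {ι : Type*} [Fintype ι] [Nonempty ι] {Ω : Type*}
    [MeasurableSpace Ω] {P : Measure Ω} [IsProbabilityMeasure P] {Y : ι → Ω → ℂ} {α : ℝ}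
    (hα : α ∈ Set.Icc (0 : ℝ) 1) (hY : ∀ a, Measurable (Y a)) (hind : iIndepFun Y P)
    (hmean : ∀ a, ∫ ω, Y a ω ∂P = 0) (hvar : ∀ a, ∫ ω, ‖Y a ω‖ ^ 2 ∂P = 1)
    (hsq : ∀ a, ∫ ω, Y a ω ^ 2 ∂P = (α : ℂ)) {c : ι → ℂ} {K δ : ℝ} (hK : 0 < K)
    (hc : ∀ a, ‖c a‖ ≤ K) (hδ : 0 < δ) (hδ1 : δ ≤ 1) :
    ‖∫ ω, exp ((∑ a, (Y a ω * c a).re / √(Fintype.card ι) : ℝ) * I) ∂P -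
        (Real.exp (-((Fintype.card ι : ℝ)⁻¹ * ∑ a, (‖c a‖ ^ 2 + α * (c a ^ 2).re) / 4)) : ℂ)‖ ≤
      δ * K ^ 2 + 4 * K ^ 2 * (1 / (Fintype.card ι : ℝ) *
        ∑ a, ∫ ω in {ω | δ / K * √(Fintype.card ι) ≤ ‖Y a ω‖}, ‖Y a ω‖ ^ 2 ∂P) +
      K ^ 4 / (Fintype.card ι : ℝ) := by
  set N : ℝ := (Fintype.card ι : ℝ) with hNdef
  have hN : 0 < N := by simp [hNdef, Fintype.card_pos]
  have hR : 0 < √N := Real.sqrt_pos.2 hN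
  have hRsq : √N ^ 2 = N := Real.sq_sqrt hN.le
  -- Half the variance of the `a`-th summand, so `exp (-v a)` is the characteristic function at 1 of
  -- the matching Gaussian.
  let v : ι → ℝ := fun a => (‖c a‖ ^ 2 + α * (c a ^ 2).re) / (4 * √N ^ 2)
  have habs : ∀ a, |α * (c a ^ 2).re| ≤ ‖c a‖ ^ 2 := fun a => by
    rw [abs_mul, abs_of_nonneg hα.1, ← norm_pow]
    exact (mul_le_of_le_one_left (abs_nonneg _) hα.2).trans (Complex.abs_re_le_norm _)
  have hv0 : ∀ a, 0 ≤ v a := fun a =>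
    div_nonneg (by linarith [(abs_le.1 (habs a)).1]) (by positivity)
  have hvK : ∀ a, v a ≤ K ^ 2 / N := fun a => by
    simp only [v, hRsq]
    have : ‖c a‖ ^ 2 ≤ K ^ 2 := by gcongr; exact hc a
    rw [div_le_div_iff₀ (by positivity) hN]
    nlinarith [(abs_le.1 (habs a)).2, sq_nonneg K]
  have hexp : ((Real.exp (-(N⁻¹ * ∑ a, (‖c a‖ ^ 2 + α * (c a ^ 2).re) / 4)) : ℝ) : ℂ) =
      ∏ a, ((Real.exp (-v a) : ℝ) : ℂ) := by
    rw [← Complex.ofReal_prod, ← Real.exp_sum, Finset.sum_neg_distrib, Finset.mul_sum]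
    congr 3
    refine Finset.sum_congr rfl fun a _ => ?_
    simp only [v, hRsq]
    field_simp
  have hprod : ∫ ω, exp (((∑ a, (Y a ω * c a).re / √N : ℝ) : ℂ) * I) ∂P =
      ∏ a, ∫ ω, exp (((Y a ω * c a).re / √N : ℝ) * I) ∂P := by
    rw [← hind.integral_fun_prod_comp (f := fun a y => exp (((y * c a).re / √N : ℝ) * I))
      (fun a => (hY a).aemeasurable) (fun a => by fun_prop)]
    refine integral_congr_ae (ae_of_all _ fun ω => ?_)
    simp only
    rw [← Complex.exp_sum, Complex.ofReal_sum, Finset.sum_mul]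
  rw [hexp, hprod]
  have hterm : ∀ a, ‖∫ ω, exp (((Y a ω * c a).re / √N : ℝ) * I) ∂P -
      ((Real.exp (-v a) : ℝ) : ℂ)‖ ≤
      (δ * K ^ 2 + 4 * K ^ 2 * ∫ ω in {ω | δ / K * √N ≤ ‖Y a ω‖}, ‖Y a ω‖ ^ 2 ∂P) / N +
        (K ^ 2 / N) ^ 2 := fun a => by
    refine (norm_sub_le_norm_sub_add_norm_sub _ ((1 - v a : ℝ) : ℂ) _).trans ?_
    refine add_le_add ?_ ?_
    · refine (norm_integral_exp_sub_le (hY a) (hvar a) (hmean a) (hsq a) hK (hc a) hδ hδ1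
        hR).trans_eq ?_
      rw [hRsq]
    · rw [← Complex.ofReal_sub, Complex.norm_real, Real.norm_eq_abs]
      refine (abs_one_sub_sub_exp_neg_le (hv0 a)).trans ?_
      have := hv0 a
      gcongr
      exact hvK a
  -- Each of the `N` factors contributes `(K²/N)²` from replacing `1 - v` by `exp (-v)`; together
  -- they give `K⁴/N`.
  refine (norm_prod_sub_prod_le_sum _ (fun a _ => ?_) fun a _ => ?_).trans
    ((Finset.sum_le_sum fun a _ => hterm a).trans_eq ?_)
  · refine (norm_integral_le_of_norm_le (integrable_const (1 : ℝ))
      (ae_of_all _ fun ω => ?_)).trans_eq (by simp)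
    rw [Complex.norm_exp_ofReal_mul_I]
  · rw [Complex.norm_real, Real.norm_of_nonneg (Real.exp_pos _).le, Real.exp_le_one_iff]
    linarith [hv0 a]
  · rw [Finset.sum_add_distrib, ← Finset.sum_div, Finset.sum_add_distrib,
      Finset.sum_const, Finset.sum_const, Finset.card_univ, ← Finset.mul_sum]
    simp only [nsmul_eq_mul, ← hNdef]
    generalize ∑ a, ∫ ω in {ω | δ / K * √N ≤ ‖Y a ω‖}, ‖Y a ω‖ ^ 2 ∂P = J
    field_simp

end Lindeberg

/-! ### Characters, diagonalization and orthogonality -/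

noncomputable section CharacterSums

open scoped ComplexConjugate

variable {G : Type*} [CommGroup G] [Fintype G]

/-- The normalized Fourier transform of `y : G → ℂ` at the character `χ`. -/
def charTransform (y : G → ℂ) (χ : AddChar (Additive G) ℂ) : ℂ :=
  ((√(Fintype.card G) : ℝ) : ℂ)⁻¹ * ∑ a, y a * χ (Additive.ofMul a)

lemma card_addChar_additive : Fintype.card (AddChar (Additive G) ℂ) = Fintype.card G :=
  AddChar.card_eq.trans (Fintype.card_congr Additive.toMul)

lemma sum_char_apply_ofMul [DecidableEq (AddChar (Additive G) ℂ)] (χ : AddChar (Additive G) ℂ) :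
    ∑ a : G, χ (Additive.ofMul a) = if χ = 0 then (Fintype.card G : ℂ) else 0 := by
  have h : ∑ a : G, χ (Additive.ofMul a) = ∑ a : Additive G, χ a :=
    Fintype.sum_equiv Additive.ofMul _ _ fun _ => rfl
  rw [h, AddChar.sum_eq_ite]
  rw [Fintype.card_congr (Additive.toMul (α := G))]

lemma sum_apply_ofMul_eq_ite [DecidableEq G] (a : G) :
    ∑ χ : AddChar (Additive G) ℂ, χ (Additive.ofMul a) =
      if a = 1 then (Fintype.card G : ℂ) else 0 := by
  classical
  rw [AddChar.sum_apply_eq_ite, Fintype.card_congr (Additive.toMul (α := G))]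
  simp only [ofMul_eq_zero]

/-- The characters diagonalize the `G`-circulant matrices. -/
lemma charpoly_circulantMatrix [DecidableEq G] (y : G → ℂ) :
    (circulantMatrix y).charpoly =
      ∏ χ : AddChar (Additive G) ℂ, (Polynomial.X - Polynomial.C (charTransform y χ)) := by
  classical
  have hN : (Fintype.card G : ℂ) ≠ 0 := by simp
  -- The columns of `U` are the inverse characters, which are the eigenvectors; `V` is its two-sided
  -- inverse by the two orthogonality relations.
  let U : Matrix G (AddChar (Additive G) ℂ) ℂ := Matrix.of fun a χ => χ (-Additive.ofMul a)
  let V : Matrix (AddChar (Additive G) ℂ) G ℂ :=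
    Matrix.of fun χ a => (Fintype.card G : ℂ)⁻¹ * χ (Additive.ofMul a)
  let D : Matrix (AddChar (Additive G) ℂ) (AddChar (Additive G) ℂ) ℂ :=
    Matrix.diagonal (charTransform y)
  have hVU : V * U = 1 := by
    ext χ ψ
    simp only [V, U, Matrix.mul_apply, Matrix.of_apply, mul_assoc, ← Finset.mul_sum]
    have : ∀ a : G, χ (Additive.ofMul a) * ψ (-Additive.ofMul a) = (χ - ψ) (Additive.ofMul a) :=
      fun a => (AddChar.sub_apply χ ψ _).symm
    simp only [this, sum_char_apply_ofMul, sub_eq_zero, Matrix.one_apply, mul_ite, mul_zero,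
      inv_mul_cancel₀ hN]
  have hUV : U * V = 1 := by
    ext a b
    simp only [V, U, Matrix.mul_apply, Matrix.of_apply]
    have : ∀ χ : AddChar (Additive G) ℂ,
        χ (-Additive.ofMul a) * ((Fintype.card G : ℂ)⁻¹ * χ (Additive.ofMul b)) =
          (Fintype.card G : ℂ)⁻¹ * χ (Additive.ofMul (a⁻¹ * b)) := fun χ => by
      rw [ofMul_mul, AddChar.map_add_eq_mul, ofMul_inv]
      ring
    simp only [this, ← Finset.mul_sum, sum_apply_ofMul_eq_ite, inv_mul_eq_one, Matrix.one_apply,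
      mul_ite, mul_zero, inv_mul_cancel₀ hN]
  have hMU : circulantMatrix y * U = U * D := by
    ext a χ
    rw [Matrix.mul_diagonal]
    simp only [circulantMatrix, U, Matrix.mul_apply, Matrix.of_apply, charTransform, mul_assoc,
      ← Finset.mul_sum]
    rw [mul_left_comm]
    congr 1
    rw [Finset.mul_sum]
    -- Substitution `c = a b⁻¹` in the convolution.
    refine Fintype.sum_equiv ((Equiv.inv G).trans (Equiv.mulLeft a)) _ _ fun b => ?_
    simp only [Equiv.trans_apply, Equiv.inv_apply, Equiv.coe_mulLeft, ofMul_mul, ofMul_inv,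
      AddChar.map_add_eq_mul]
    have h1 : χ (-Additive.ofMul a) * χ (Additive.ofMul a) = 1 := by
      rw [← AddChar.map_add_eq_mul, neg_add_cancel, AddChar.map_zero_eq_one]
    linear_combination (-(y (a * b⁻¹)) * χ (-Additive.ofMul b)) * h1
  have hM : circulantMatrix y = U * (D * V) := by
    rw [← Matrix.mul_assoc, ← hMU, Matrix.mul_assoc, hUV, Matrix.mul_one]
  -- `U` and `V` have different index types, so similarity is replaced by the comparison of the
  -- characteristic polynomials of `U (D V)` and `(D V) U`; equal cardinalities make the extra power
  -- of `X` trivial.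
  rw [hM, Matrix.charpoly_mul_comm_of_le _ _ card_addChar_additive.le, card_addChar_additive,
    Nat.sub_self, pow_zero, one_mul, Matrix.mul_assoc, hVU, Matrix.mul_one,
    Matrix.charpoly_diagonal]

lemma empiricalSpectralMeasure_circulantMatrix [DecidableEq G] (y : G → ℂ) :
    empiricalSpectralMeasure (circulantMatrix y) =
      averageMeasure fun χ : AddChar (Additive G) ℂ => Measure.dirac (charTransform y χ) := by
  have h : (circulantMatrix y).charpoly.roots =
      Finset.univ.val.map (charTransform y) := by
    rw [charpoly_circulantMatrix, Finset.prod_eq_multiset_prod]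
    have := Polynomial.roots_multiset_prod_X_sub_C
      ((Finset.univ : Finset (AddChar (Additive G) ℂ)).val.map (charTransform y))
    rwa [Multiset.map_map] at this
  rw [empiricalSpectralMeasure, averageMeasure, h, Multiset.map_map, card_addChar_additive]
  rfl

open scoped Classical in
/-- The number of characters of order at most two equals the number of such elements. -/
lemma card_filter_addChar_add_self_eq_zero :
    (Finset.univ.filter fun χ : AddChar (Additive G) ℂ => χ + χ = 0).card =
      Nat.card {a : G // a ^ 2 = 1} := by
  have hN : (Fintype.card G : ℂ) ≠ 0 := by simp
  -- Double counting of `∑ χ(a)²`: summing over `a` first counts the `χ` with `χ² = 1`, summing over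
  -- `χ` first counts the `a` with `a² = 1`, each with factor `|G|`.
  have h : ∑ χ : AddChar (Additive G) ℂ, ∑ a : G, (χ + χ) (Additive.ofMul a) =
      ∑ a : G, ∑ χ : AddChar (Additive G) ℂ, χ (Additive.ofMul (a ^ 2)) := by
    rw [Finset.sum_comm]
    refine Finset.sum_congr rfl fun a _ => Finset.sum_congr rfl fun χ _ => ?_
    rw [sq, ofMul_mul, AddChar.map_add_eq_mul, AddChar.add_apply]
  simp only [sum_char_apply_ofMul, sum_apply_ofMul_eq_ite, ← Finset.sum_filter,
    Finset.sum_const, nsmul_eq_mul] at h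
  have h' := mul_right_cancel₀ hN h
  rw [Nat.card_eq_fintype_card, Fintype.card_subtype]
  exact_mod_cast h'

open scoped Classical in
/-- The limiting exponent of the characteristic function of the transform at `χ`. -/
def charExponent (α : ℝ) (χ : AddChar (Additive G) ℂ) (s : ℂ) : ℝ :=
  (‖s‖ ^ 2 + α * if χ + χ = 0 then (s ^ 2).re else 0) / 4

omit [Fintype G] in
lemma charExponent_nonneg {α : ℝ} (hα : α ∈ Set.Icc (0 : ℝ) 1) (χ : AddChar (Additive G) ℂ)
    (s : ℂ) : 0 ≤ charExponent α χ s := by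
  unfold charExponent
  have h1 : |α * (s ^ 2).re| ≤ ‖s‖ ^ 2 := by
    rw [abs_mul, abs_of_nonneg hα.1, ← norm_pow]
    exact (mul_le_of_le_one_left (abs_nonneg _) hα.2).trans (Complex.abs_re_le_norm _)
  split_ifs
  · linarith [(abs_le.1 h1).1]
  · rw [mul_zero, add_zero]
    positivity

/-- The cross term of the squared modulus carries the character `χ - ψ`, that of the square carries
`χ + ψ`. Both are nontrivial and sum to zero over `G`, so only the diagonal terms remain. -/
lemma sum_variance_pair_eq (α : ℝ) {χ ψ : AddChar (Additive G) ℂ} (h1 : χ ≠ ψ) (h2 : χ + ψ ≠ 0)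
    (s t : ℂ) :
    (Fintype.card G : ℝ)⁻¹ * ∑ a : G,
      (‖χ (Additive.ofMul a) * conj s + ψ (Additive.ofMul a) * conj t‖ ^ 2 +
        α * ((χ (Additive.ofMul a) * conj s + ψ (Additive.ofMul a) * conj t) ^ 2).re) / 4 =
      charExponent α χ s + charExponent α ψ t := by
  classical
  have hN : (Fintype.card G : ℝ) ≠ 0 := by simp
  have hz (φ : AddChar (Additive G) ℂ) (hφ : φ ≠ 0) (w : ℂ) :
      ∑ a : G, (φ (Additive.ofMul a) * w).re = 0 := by
    rw [← Complex.re_sum, ← Finset.sum_mul, sum_char_apply_ofMul, if_neg hφ, zero_mul,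
      Complex.zero_re]
  have hdiag (φ : AddChar (Additive G) ℂ) (w : ℂ) :
      ∑ a : G, ((φ + φ) (Additive.ofMul a) * conj w ^ 2).re =
        Fintype.card G * if φ + φ = 0 then (w ^ 2).re else 0 := by
    rw [← Complex.re_sum, ← Finset.sum_mul, sum_char_apply_ofMul]
    split_ifs
    · rw [← map_pow, ← Complex.ofReal_natCast, Complex.re_ofReal_mul, Complex.conj_re]
    · simp
  have hnorm (a : G) : ‖χ (Additive.ofMul a) * conj s + ψ (Additive.ofMul a) * conj t‖ ^ 2 =
      ‖s‖ ^ 2 + ‖t‖ ^ 2 + 2 * ((χ - ψ) (Additive.ofMul a) * (conj s * t)).re := by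
    have e : χ (Additive.ofMul a) * conj s * conj (ψ (Additive.ofMul a) * conj t) =
        (χ - ψ) (Additive.ofMul a) * (conj s * t) := by
      rw [AddChar.sub_apply, AddChar.map_neg_eq_conj, map_mul, Complex.conj_conj]
      ring
    rw [Complex.sq_norm, Complex.normSq_add, e, ← Complex.sq_norm, ← Complex.sq_norm]
    simp [AddChar.norm_apply]
  have hsq (a : G) : ((χ (Additive.ofMul a) * conj s + ψ (Additive.ofMul a) * conj t) ^ 2).re =
      ((χ + χ) (Additive.ofMul a) * conj s ^ 2).re + ((ψ + ψ) (Additive.ofMul a) * conj t ^ 2).re +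
        2 * ((χ + ψ) (Additive.ofMul a) * (conj s * conj t)).re := by
    have e : (χ (Additive.ofMul a) * conj s + ψ (Additive.ofMul a) * conj t) ^ 2 =
        (χ + χ) (Additive.ofMul a) * conj s ^ 2 + (ψ + ψ) (Additive.ofMul a) * conj t ^ 2 +
        ((2 : ℝ) : ℂ) * ((χ + ψ) (Additive.ofMul a) * (conj s * conj t)) := by
      simp only [AddChar.add_apply]
      push_cast
      ring
    rw [e, Complex.add_re, Complex.add_re, Complex.re_ofReal_mul]
  simp only [hnorm, hsq]
  rw [← Finset.sum_div, Finset.sum_add_distrib, Finset.sum_add_distrib, ← Finset.mul_sum,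
    ← Finset.mul_sum, Finset.sum_add_distrib, Finset.sum_add_distrib, ← Finset.mul_sum,
    hz _ (sub_ne_zero.2 h1), hz _ h2, Finset.sum_add_distrib, hdiag, hdiag, ← Finset.sum_add_distrib, Finset.sum_const, Finset.card_univ,
    nsmul_eq_mul]
  unfold charExponent
  field_simp
  ring

lemma average_exp_neg_charExponent (α : ℝ) (s : ℂ) :
    (Fintype.card (AddChar (Additive G) ℂ) : ℝ)⁻¹ *
      ∑ χ : AddChar (Additive G) ℂ, Real.exp (-charExponent α χ s) =
      (1 - propOrderTwo G) * Real.exp (-(‖s‖ ^ 2 / 4)) +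
        propOrderTwo G * Real.exp (-((‖s‖ ^ 2 + α * (s ^ 2).re) / 4)) := by
  classical
  have hN : (Fintype.card G : ℝ) ≠ 0 := by simp
  have e (χ : AddChar (Additive G) ℂ) : Real.exp (-charExponent α χ s) =
      Real.exp (-(‖s‖ ^ 2 / 4)) + if χ + χ = 0 then
        Real.exp (-((‖s‖ ^ 2 + α * (s ^ 2).re) / 4)) - Real.exp (-(‖s‖ ^ 2 / 4)) else 0 := by
    unfold charExponent
    split_ifs <;> simp
  simp only [e, Finset.sum_add_distrib, Finset.sum_const, Finset.card_univ, ← Finset.sum_filter,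
    nsmul_eq_mul]
  have hc := card_filter_addChar_add_self_eq_zero (G := G)
  rw [card_addChar_additive, propOrderTwo, ← hc]
  field_simp
  ring_nf

end CharacterSums

/-! ### Characteristic functions of the limit laws -/

section GaussianCharFun

open scoped RealInnerProductSpace

instance (α : ℝ) : IsProbabilityMeasure (gaussianComplex α) :=
  Measure.isProbabilityMeasure_map (by
    have : (fun x : ℝ × ℝ => (⟨x.1, x.2⟩ : ℂ)) = Complex.measurableEquivRealProd.symm := rfl
    rw [this]
    exact Complex.measurableEquivRealProd.symm.measurable.aemeasurable)

lemma stdGaussianComplex_eq : stdGaussianComplex = gaussianComplex 0 := by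
  have h : ((1 : ℝ) / 2).toNNReal = 1 / 2 := by
    rw [Real.toNNReal_div zero_le_one]
    simp
  rw [stdGaussianComplex, gaussianComplex, add_zero, sub_zero, h]

lemma charFun_gaussianComplex {α : ℝ} (hα : α ∈ Set.Icc (0 : ℝ) 1) (s : ℂ) :
    charFun (gaussianComplex α) s =
      (Real.exp (-((‖s‖ ^ 2 + α * (s ^ 2).re) / 4)) : ℂ) := by
  have hm : Measurable fun x : ℝ × ℝ => (⟨x.1, x.2⟩ : ℂ) :=
    Complex.measurableEquivRealProd.symm.measurable
  rw [charFun_apply, gaussianComplex, integral_map hm.aemeasurable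
    (by fun_prop : Continuous fun x : ℂ => Complex.exp ((⟪x, s⟫ : ℝ) * Complex.I)
      ).aestronglyMeasurable]
  have e (x : ℝ × ℝ) : Complex.exp ((⟪(⟨x.1, x.2⟩ : ℂ), s⟫ : ℝ) * Complex.I) =
      Complex.exp (s.re * x.1 * Complex.I) * Complex.exp (s.im * x.2 * Complex.I) := by
    rw [← Complex.exp_add, real_inner_comm, Complex.inner]
    congr 1
    simp
    ring
  simp only [e]
  rw [integral_prod_mul (fun x : ℝ => Complex.exp (s.re * x * Complex.I))
      (fun x : ℝ => Complex.exp (s.im * x * Complex.I)), ← charFun_apply_real,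
    ← charFun_apply_real, charFun_gaussianReal, charFun_gaussianReal, ← Complex.exp_add,
    Complex.ofReal_exp]
  congr 1
  have h1 : (((1 + α) / 2).toNNReal : ℝ) = (1 + α) / 2 :=
    Real.coe_toNNReal _ (by linarith [hα.1])
  have h2 : (((1 - α) / 2).toNNReal : ℝ) = (1 - α) / 2 :=
    Real.coe_toNNReal _ (by linarith [hα.2])
  -- Matches the exponent from the circulant side with the covariance quadratic form.
  have h3 : ‖s‖ ^ 2 + α * (s ^ 2).re = (1 + α) * s.re ^ 2 + (1 - α) * s.im ^ 2 := by
    rw [Complex.sq_norm, Complex.normSq_apply, sq s, Complex.mul_re]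
    ring
  rw [h3]
  have h1' : ((((1 + α) / 2).toNNReal : ℝ) : ℂ) = (1 + α) / 2 := by rw [h1]; push_cast; ring
  have h2' : ((((1 - α) / 2).toNNReal : ℝ) : ℂ) = (1 - α) / 2 := by rw [h2]; push_cast; ring
  rw [h1', h2']
  push_cast
  ring

variable {α p : ℝ}

lemma isProbabilityMeasure_gaussianMixture (hp : p ∈ Set.Icc (0 : ℝ) 1) :
    IsProbabilityMeasure
      (ENNReal.ofReal (1 - p) • stdGaussianComplex + ENNReal.ofReal p • gaussianComplex α) := by
  constructor
  rw [stdGaussianComplex_eq]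
  simp only [Measure.add_apply, Measure.smul_apply, measure_univ, smul_eq_mul, mul_one]
  rw [← ENNReal.ofReal_add (by linarith [hp.2]) hp.1]
  simp

lemma charFun_gaussianMixture (hα : α ∈ Set.Icc (0 : ℝ) 1) (hp : p ∈ Set.Icc (0 : ℝ) 1) (s : ℂ) :
    charFun (ENNReal.ofReal (1 - p) • stdGaussianComplex + ENNReal.ofReal p • gaussianComplex α) s =
      (((1 - p) * Real.exp (-(‖s‖ ^ 2 / 4)) +
        p * Real.exp (-((‖s‖ ^ 2 + α * (s ^ 2).re) / 4)) : ℝ) : ℂ) := by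
  have hi (β : ℝ) : Integrable (fun x : ℂ => Complex.exp ((⟪x, s⟫ : ℝ) * Complex.I))
      (gaussianComplex β) :=
    Integrable.of_bound (by fun_prop : Continuous fun x : ℂ =>
      Complex.exp ((⟪x, s⟫ : ℝ) * Complex.I)).aestronglyMeasurable 1 (ae_of_all _ fun x => by
        rw [Complex.norm_exp_ofReal_mul_I])
  rw [stdGaussianComplex_eq, charFun_apply,
    integral_add_measure ((hi 0).smul_measure ENNReal.ofReal_ne_top)
      ((hi α).smul_measure ENNReal.ofReal_ne_top), integral_smul_measure, integral_smul_measure,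
    ← charFun_apply, ← charFun_apply, charFun_gaussianComplex hα,
    charFun_gaussianComplex ⟨le_rfl, zero_le_one⟩, ENNReal.toReal_ofReal hp.1,
    ENNReal.toReal_ofReal (by linarith [hp.2])]
  simp

end GaussianCharFun

/-! ### Pairs of Fourier coefficients and the limit -/

section CirculantLimit

open scoped RealInnerProductSpace ComplexConjugate

section SingleGroup

variable {G : Type*} [CommGroup G] [Fintype G] {Ω : Type*} [MeasurableSpace Ω] {P : Measure Ω}
  [IsProbabilityMeasure P] {Y : G → Ω → ℂ} {α : ℝ}

lemma measurable_charTransform (hY : ∀ a, Measurable (Y a)) (χ : AddChar (Additive G) ℂ) :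
    Measurable fun ω => charTransform (fun a => Y a ω) χ := by
  unfold charTransform
  fun_prop

omit [IsProbabilityMeasure P] [MeasurableSpace Ω] in
-- Exhibits the exponent as a weighted sum of independent variables, the form the Lindeberg bound
-- takes; the conjugates come from `⟪z, s⟫ = Re (z * conj s)`.
lemma inner_charTransform_add (χ ψ : AddChar (Additive G) ℂ) (s t : ℂ) (ω : Ω) :
    (⟪charTransform (fun a => Y a ω) χ, s⟫ + ⟪charTransform (fun a => Y a ω) ψ, t⟫ : ℝ) =
      ∑ a, (Y a ω * (χ (Additive.ofMul a) * conj s + ψ (Additive.ofMul a) * conj t)).re /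
        √(Fintype.card G) := by
  have h (φ : AddChar (Additive G) ℂ) (w : ℂ) : ⟪charTransform (fun a => Y a ω) φ, w⟫ =
      ∑ a, (Y a ω * (φ (Additive.ofMul a) * conj w)).re / √(Fintype.card G) := by
    rw [real_inner_comm, Complex.inner, charTransform, ← Complex.ofReal_inv, mul_assoc,
      Complex.re_ofReal_mul, Finset.sum_mul, Complex.re_sum, Finset.mul_sum]
    refine Finset.sum_congr rfl fun a _ => ?_
    rw [mul_assoc, inv_mul_eq_div]
  rw [h, h, ← Finset.sum_add_distrib]
  refine Finset.sum_congr rfl fun a _ => ?_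
  rw [← add_div, ← Complex.add_re, ← mul_add]

/-- The joint characteristic function of the transforms at `χ` and `ψ` is close to the product of
the limiting ones, up to the Lindeberg error, unless `χ = ψ` or `χ + ψ = 0`. -/
lemma norm_charFun_pair_sub_le [DecidableEq (AddChar (Additive G) ℂ)]
    (hα : α ∈ Set.Icc (0 : ℝ) 1) (hY : ∀ a, Measurable (Y a))
    (hind : iIndepFun Y P) (hmean : ∀ a, ∫ ω, Y a ω ∂P = 0)
    (hvar : ∀ a, ∫ ω, ‖Y a ω‖ ^ 2 ∂P = 1) (hsq : ∀ a, ∫ ω, Y a ω ^ 2 ∂P = (α : ℂ)) (s t : ℂ)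
    {K δ : ℝ} (hK : 0 < K) (hst : ‖s‖ + ‖t‖ ≤ K) (hδ : 0 < δ) (hδ1 : δ ≤ 1)
    (χ ψ : AddChar (Additive G) ℂ) :
    ‖∫ ω, Complex.exp ((⟪charTransform (fun a => Y a ω) χ, s⟫ +
        ⟪charTransform (fun a => Y a ω) ψ, t⟫ : ℝ) * Complex.I) ∂P -
        ((Real.exp (-charExponent α χ s) * Real.exp (-charExponent α ψ t) : ℝ) : ℂ)‖ ≤
      δ * K ^ 2 + 4 * K ^ 2 * (1 / (Fintype.card G : ℝ) *
        ∑ a, ∫ ω in {ω | δ / K * √(Fintype.card G) ≤ ‖Y a ω‖}, ‖Y a ω‖ ^ 2 ∂P) +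
      K ^ 4 / (Fintype.card G : ℝ) +
      ((if χ = ψ then 2 else 0) + if χ = -ψ then 2 else 0) := by
  have hnonneg : 0 ≤ δ * K ^ 2 + 4 * K ^ 2 * (1 / (Fintype.card G : ℝ) *
        ∑ a, ∫ ω in {ω | δ / K * √(Fintype.card G) ≤ ‖Y a ω‖}, ‖Y a ω‖ ^ 2 ∂P) +
      K ^ 4 / (Fintype.card G : ℝ) := by
    have : 0 ≤ ∑ a, ∫ ω in {ω | δ / K * √(Fintype.card G) ≤ ‖Y a ω‖}, ‖Y a ω‖ ^ 2 ∂P :=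
      Finset.sum_nonneg fun a _ => integral_nonneg fun ω => sq_nonneg _
    positivity
  -- For exceptional pairs the trivial bound suffices: both quantities have norm at most 1, so they
  -- differ by at most 2.
  by_cases hbad : χ = ψ ∨ χ = -ψ
  · have h2 : (2 : ℝ) ≤ (if χ = ψ then 2 else 0) + if χ = -ψ then 2 else 0 := by
      rcases hbad with h | h
      · rw [if_pos h]
        split_ifs <;> norm_num
      · rw [if_pos h]
        split_ifs <;> norm_num
    have h3 : ‖∫ ω, Complex.exp ((⟪charTransform (fun a => Y a ω) χ, s⟫ +
        ⟪charTransform (fun a => Y a ω) ψ, t⟫ : ℝ) * Complex.I) ∂P‖ ≤ 1 := by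
      refine (norm_integral_le_of_norm_le (integrable_const (1 : ℝ))
        (ae_of_all _ fun ω => ?_)).trans_eq (by simp)
      rw [Complex.norm_exp_ofReal_mul_I]
    have h4 : ‖((Real.exp (-charExponent α χ s) * Real.exp (-charExponent α ψ t) : ℝ) : ℂ)‖ ≤ 1 := by
      rw [Complex.norm_real, ← Real.exp_add, Real.norm_of_nonneg (Real.exp_pos _).le,
        Real.exp_le_one_iff]
      linarith [charExponent_nonneg hα χ s, charExponent_nonneg hα ψ t]
    linarith [norm_sub_le (∫ ω, Complex.exp ((⟪charTransform (fun a => Y a ω) χ, s⟫ +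
        ⟪charTransform (fun a => Y a ω) ψ, t⟫ : ℝ) * Complex.I) ∂P)
        ((Real.exp (-charExponent α χ s) * Real.exp (-charExponent α ψ t) : ℝ) : ℂ)]
  · push Not at hbad
    rw [if_neg hbad.1, if_neg hbad.2, add_zero, add_zero]
    have hc (a : G) :
        ‖χ (Additive.ofMul a) * conj s + ψ (Additive.ofMul a) * conj t‖ ≤ K := by
      refine (norm_add_le _ _).trans (le_trans (le_of_eq ?_) hst)
      simp [AddChar.norm_apply]
    have h := norm_integral_exp_sum_sub_exp_le hα hY hind hmean hvar hsq hK hc hδ hδ1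
    rw [sum_variance_pair_eq α hbad.1 (fun h => hbad.2 (eq_neg_of_add_eq_zero_left h)),
      neg_add, Real.exp_add] at h
    simp only [inner_charTransform_add]
    exact h

lemma norm_average_charFun_pair_sub_le (hα : α ∈ Set.Icc (0 : ℝ) 1) (hY : ∀ a, Measurable (Y a))
    (hind : iIndepFun Y P) (hmean : ∀ a, ∫ ω, Y a ω ∂P = 0)
    (hvar : ∀ a, ∫ ω, ‖Y a ω‖ ^ 2 ∂P = 1) (hsq : ∀ a, ∫ ω, Y a ω ^ 2 ∂P = (α : ℂ)) (s t : ℂ)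
    {K δ : ℝ} (hK : 0 < K) (hst : ‖s‖ + ‖t‖ ≤ K) (hδ : 0 < δ) (hδ1 : δ ≤ 1) :
    ‖((Fintype.card (AddChar (Additive G) ℂ × AddChar (Additive G) ℂ) : ℝ)⁻¹ : ℝ) •
      ∑ q : AddChar (Additive G) ℂ × AddChar (Additive G) ℂ,
        ∫ ω, Complex.exp ((⟪charTransform (fun a => Y a ω) q.1, s⟫ +
        ⟪charTransform (fun a => Y a ω) q.2, t⟫ : ℝ) * Complex.I) ∂P -
      ((((1 - propOrderTwo G) * Real.exp (-(‖s‖ ^ 2 / 4)) +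
        propOrderTwo G * Real.exp (-((‖s‖ ^ 2 + α * (s ^ 2).re) / 4))) *
        ((1 - propOrderTwo G) * Real.exp (-(‖t‖ ^ 2 / 4)) +
        propOrderTwo G * Real.exp (-((‖t‖ ^ 2 + α * (t ^ 2).re) / 4))) : ℝ) : ℂ)‖ ≤
      δ * K ^ 2 + 4 * K ^ 2 * (1 / (Fintype.card G : ℝ) *
        ∑ a, ∫ ω in {ω | δ / K * √(Fintype.card G) ≤ ‖Y a ω‖}, ‖Y a ω‖ ^ 2 ∂P) +
      (K ^ 4 + 4) / (Fintype.card G : ℝ) := by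
  classical
  have hN : (0 : ℝ) < Fintype.card G := by simp [Fintype.card_pos]
  have hcard : (Fintype.card (AddChar (Additive G) ℂ × AddChar (Additive G) ℂ) : ℝ) =
      (Fintype.card G : ℝ) ^ 2 := by
    rw [Fintype.card_prod, card_addChar_additive]
    push_cast
    ring
  have hprod : ((1 - propOrderTwo G) * Real.exp (-(‖s‖ ^ 2 / 4)) +
        propOrderTwo G * Real.exp (-((‖s‖ ^ 2 + α * (s ^ 2).re) / 4))) *
        ((1 - propOrderTwo G) * Real.exp (-(‖t‖ ^ 2 / 4)) +
        propOrderTwo G * Real.exp (-((‖t‖ ^ 2 + α * (t ^ 2).re) / 4))) =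
      ((Fintype.card G : ℝ) ^ 2)⁻¹ * ∑ q : AddChar (Additive G) ℂ × AddChar (Additive G) ℂ,
        Real.exp (-charExponent α q.1 s) * Real.exp (-charExponent α q.2 t) := by
    rw [← average_exp_neg_charExponent, ← average_exp_neg_charExponent, Fintype.sum_prod_type]
    simp only
    rw [← Finset.sum_mul_sum, card_addChar_additive]
    ring
  -- For each second character, one first character satisfies each equation, giving `2 + 2`;
  -- division by `|G|²` leaves `4/|G|`.
  have hsum : ∑ q : AddChar (Additive G) ℂ × AddChar (Additive G) ℂ,
      ((if q.1 = q.2 then (2 : ℝ) else 0) + if q.1 = -q.2 then 2 else 0) =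
      4 * Fintype.card G := by
    rw [Fintype.sum_prod_type_right, ← card_addChar_additive]
    simp only [Finset.sum_add_distrib, Finset.sum_ite_eq', Finset.mem_univ, if_true,
      Finset.sum_const, Finset.card_univ, nsmul_eq_mul]
    ring
  rw [hprod, hcard, Complex.ofReal_mul, Complex.ofReal_sum, Complex.real_smul, ← mul_sub,
    ← Finset.sum_sub_distrib, norm_mul, Complex.norm_real,
    Real.norm_of_nonneg (by positivity)]
  have hle := (norm_sum_le (Finset.univ : Finset (AddChar (Additive G) ℂ × AddChar (Additive G) ℂ))
    _).trans (Finset.sum_le_sum fun q _ =>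
      norm_charFun_pair_sub_le hα hY hind hmean hvar hsq s t hK hst hδ hδ1 q.1 q.2)
  rw [Finset.sum_add_distrib, hsum, Finset.sum_const, Finset.card_univ, nsmul_eq_mul, hcard] at hle
  refine (mul_le_mul_of_nonneg_left hle (by positivity)).trans_eq ?_
  generalize 1 / (Fintype.card G : ℝ) *
    ∑ a, ∫ ω in {ω | δ / K * √(Fintype.card G) ≤ ‖Y a ω‖}, ‖Y a ω‖ ^ 2 ∂P = J
  field_simp
  ring

end SingleGroup

variable {G : ℕ → Type*} [∀ n, CommGroup (G n)] [∀ n, Fintype (G n)]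
  {Ω : ℕ → Type*} [∀ n, MeasurableSpace (Ω n)] {P : ∀ n, Measure (Ω n)}
  [∀ n, IsProbabilityMeasure (P n)] {Y : ∀ n, G n → Ω n → ℂ} {α p : ℝ}

/-- Ensures that `ENNReal.ofReal` truncates neither mixture weight, so that the limit is a
probability measure. -/
lemma mem_Icc_of_tendsto_propOrderTwo
    (hp : Tendsto (fun n => propOrderTwo (G n)) atTop (𝓝 p)) : p ∈ Set.Icc (0 : ℝ) 1 := by
  refine isClosed_Icc.mem_of_tendsto hp (Eventually.of_forall fun n => ⟨?_, ?_⟩)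
  · unfold propOrderTwo
    positivity
  · unfold propOrderTwo
    refine div_le_one_of_le₀ ?_ (Nat.cast_nonneg _)
    rw [← Nat.card_eq_fintype_card]
    exact_mod_cast Finite.card_subtype_le _

lemma tendsto_average_charFun_pair (hG : Tendsto (fun n => Fintype.card (G n)) atTop atTop)
    (hmeas : ∀ n a, Measurable (Y n a)) (hindep : ∀ n, iIndepFun (Y n) (P n))
    (hα : α ∈ Set.Icc (0 : ℝ) 1) (hmean : ∀ n a, ∫ ω, Y n a ω ∂(P n) = 0)
    (hvar : ∀ n a, ∫ ω, ‖Y n a ω‖ ^ 2 ∂(P n) = 1)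
    (hsq : ∀ n a, ∫ ω, (Y n a ω) ^ 2 ∂(P n) = (α : ℂ)) (hLind : LindebergCondition P Y)
    (hp : Tendsto (fun n => propOrderTwo (G n)) atTop (𝓝 p)) (s t : ℂ) :
    Tendsto (fun n =>
      ((Fintype.card (AddChar (Additive (G n)) ℂ × AddChar (Additive (G n)) ℂ) : ℝ)⁻¹ : ℝ) •
      ∑ q : AddChar (Additive (G n)) ℂ × AddChar (Additive (G n)) ℂ,
        ∫ ω, Complex.exp ((⟪charTransform (fun a => Y n a ω) q.1, s⟫ +
        ⟪charTransform (fun a => Y n a ω) q.2, t⟫ : ℝ) * Complex.I) ∂(P n)) atTop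
      (𝓝 ((((1 - p) * Real.exp (-(‖s‖ ^ 2 / 4)) +
        p * Real.exp (-((‖s‖ ^ 2 + α * (s ^ 2).re) / 4)) : ℝ) : ℂ) *
        (((1 - p) * Real.exp (-(‖t‖ ^ 2 / 4)) +
        p * Real.exp (-((‖t‖ ^ 2 + α * (t ^ 2).re) / 4)) : ℝ) : ℂ))) := by
  have hlim : Tendsto (fun n => ((((1 - propOrderTwo (G n)) * Real.exp (-(‖s‖ ^ 2 / 4)) +
        propOrderTwo (G n) * Real.exp (-((‖s‖ ^ 2 + α * (s ^ 2).re) / 4))) *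
        ((1 - propOrderTwo (G n)) * Real.exp (-(‖t‖ ^ 2 / 4)) +
        propOrderTwo (G n) * Real.exp (-((‖t‖ ^ 2 + α * (t ^ 2).re) / 4))) : ℝ) : ℂ)) atTop
      (𝓝 ((((1 - p) * Real.exp (-(‖s‖ ^ 2 / 4)) +
        p * Real.exp (-((‖s‖ ^ 2 + α * (s ^ 2).re) / 4)) : ℝ) : ℂ) *
        (((1 - p) * Real.exp (-(‖t‖ ^ 2 / 4)) +
        p * Real.exp (-((‖t‖ ^ 2 + α * (t ^ 2).re) / 4)) : ℝ) : ℂ))) := by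
    rw [← Complex.ofReal_mul]
    refine (Complex.continuous_ofReal.tendsto _).comp (Tendsto.mul ?_ ?_) <;>
    exact ((tendsto_const_nhds.sub hp).mul_const _).add (hp.mul_const _)
  -- The comparison value still depends on `n` through `propOrderTwo (G n)`; it remains to send the
  -- distance to it to zero.
  refine (tendsto_iff_of_dist ?_).2 hlim
  set K : ℝ := ‖s‖ + ‖t‖ + 1 with hKdef
  have hK : 0 < K := by positivity
  rw [Metric.tendsto_atTop']
  intro ε hε
  -- The truncation level is fixed first, so that `δ K²` costs at most `ε/2`; the Lindeberg
  -- condition at level `δ / K` and the growth of `|G n|` then make the rest smaller than `ε/2`.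
  set δ : ℝ := min 1 (ε / 2 / K ^ 2)
  have hδ : 0 < δ := lt_min one_pos (by positivity)
  have hδK : δ * K ^ 2 ≤ ε / 2 := by
    rw [← le_div_iff₀ (by positivity)]
    exact min_le_right _ _
  have hN : Tendsto (fun n => (Fintype.card (G n) : ℝ)) atTop atTop :=
    tendsto_natCast_atTop_atTop.comp hG
  have hB : Tendsto (fun n => 4 * K ^ 2 * (1 / (Fintype.card (G n) : ℝ) *
        ∑ a, ∫ ω in {ω | δ / K * √(Fintype.card (G n)) ≤ ‖Y n a ω‖}, ‖Y n a ω‖ ^ 2 ∂(P n)) +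
      (K ^ 4 + 4) / (Fintype.card (G n) : ℝ)) atTop (𝓝 0) := by
    have := ((hLind (δ / K) (by positivity)).const_mul (4 * K ^ 2)).add
      (hN.const_div_atTop (K ^ 4 + 4))
    simpa only [mul_zero, add_zero] using this
  obtain ⟨n₀, hn₀⟩ := eventually_atTop.1 (hB.eventually_lt_const (half_pos hε))
  refine ⟨n₀, fun n hn => ?_⟩
  rw [Real.dist_0_eq_abs, abs_of_nonneg dist_nonneg, dist_eq_norm]
  refine (norm_average_charFun_pair_sub_le hα (hmeas n) (hindep n) (hmean n) (hvar n) (hsq n) s t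
    hK (by linarith) hδ (min_le_left _ _)).trans_lt ?_
  linarith [hn₀ n hn.le]

end CirculantLimit

/-! ### The main theorem -/

theorem theoremT
    {G : ℕ → Type*} [∀ n, CommGroup (G n)] [∀ n, Fintype (G n)] [∀ n, DecidableEq (G n)]
    (hG : Tendsto (fun n => Fintype.card (G n)) atTop atTop)
    {Ω : ℕ → Type*} [∀ n, MeasurableSpace (Ω n)]
    (P : ∀ n, Measure (Ω n)) [∀ n, IsProbabilityMeasure (P n)]
    (Y : ∀ n, G n → Ω n → ℂ)
    (hmeas : ∀ n a, Measurable (Y n a))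
    (hindep : ∀ n, iIndepFun (Y n) (P n))
    (α : ℝ) (hα : α ∈ Set.Icc (0 : ℝ) 1)
    (hmean : ∀ n a, ∫ ω, Y n a ω ∂(P n) = 0)
    (hvar : ∀ n a, ∫ ω, ‖Y n a ω‖ ^ 2 ∂(P n) = 1)
    (hsq : ∀ n a, ∫ ω, (Y n a ω) ^ 2 ∂(P n) = (α : ℂ))
    (hLind : LindebergCondition P Y)
    (p : ℝ) (hp : Tendsto (fun n => propOrderTwo (G n)) atTop (𝓝 p)) :
    WeaklyConvergesInMean P
        (fun n ω => empiricalSpectralMeasure (circulantMatrix fun a => Y n a ω))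
        (ENNReal.ofReal (1 - p) • stdGaussianComplex + ENNReal.ofReal p • gaussianComplex α) ∧
      WeaklyConvergesInProbability P
        (fun n ω => empiricalSpectralMeasure (circulantMatrix fun a => Y n a ω))
        (ENNReal.ofReal (1 - p) • stdGaussianComplex + ENNReal.ofReal p • gaussianComplex α) := by

  have hp' := mem_Icc_of_tendsto_propOrderTwo hp
  have := isProbabilityMeasure_gaussianMixture (α := α) hp'
  have hZ (n : ℕ) (χ : AddChar (Additive (G n)) ℂ) :
      Measurable fun ω => charTransform (fun a => Y n a ω) χ :=
    measurable_charTransform (hmeas n) χ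
  have hpair := tendsto_average_integral_mul_of_tendsto_charFun (P := P)
    (ν := ENNReal.ofReal (1 - p) • stdGaussianComplex + ENNReal.ofReal p • gaussianComplex α)
    hZ fun s t => by
      rw [charFun_gaussianMixture hα hp', charFun_gaussianMixture hα hp']
      exact tendsto_average_charFun_pair hG hmeas hindep hα hmean hvar hsq hLind hp s t
  simp only [empiricalSpectralMeasure_circulantMatrix]
  exact ⟨weaklyConvergesInMean_of_tendsto_average hZ hpair,
    weaklyConvergesInProbability_of_tendsto_average hZ hpair⟩
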